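/- Let $\mathbb{F}$ be a division ring, $\sigma : \mathbb{F} \to \mathbb{F}^{n \times n}$ a (unital) ring morphism and $\delta : \mathbb{F} \to \mathbb{F}^n$ a $\sigma$-derivation, that is, an additive map with $\delta(bc) = \sigma(b)\delta(c) + \delta(b)c$ for all $b,c \in \mathbb{F}$. Let $R = \mathbb{F}[\mathbf{x};\sigma,\delta]$ be the free multivariate skew polynomial ring: the left $\mathbb{F}$-vector space whose basis is the free monoid $\mathcal{M}$ on the letters $x_1,\ldots,x_n$, with the product given by appending monomials and by the rule $x_i b = \sum_{j=1}^n \sigma_{i,j}(b) x_j + \delta_i(b)$ for $b \in \mathbb{F}$. Fix $\mathbf{a} \in \mathbb{F}^n$. Define $\mathcal{D}_{\mathbf{a}} = (\mathcal{D}_{\mathbf{a}}^{x_1},\ldots,\mathcal{D}_{\mathbf{a}}^{x_n}) : \mathbb{F} \to \mathbb{F}^n$ by $\mathcal{D}_{\mathbf{a}}(\beta) = \sigma(\beta)\mathbf{a} + \delta(\beta)$, and operators $\mathcal{D}_{\mathbf{a}}^{\mathfrak{m}} : \mathbb{F} \to \mathbb{F}$ for $\mathfrak{m} \in \mathcal{M}$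 by $\mathcal{D}_{\mathbf{a}}^1 = \mathrm{Id}$ and $\mathcal{D}_{\mathbf{a}}^{x_i \mathfrak{m}} = \mathcal{D}_{\mathbf{a}}^{x_i} \circ \mathcal{D}_{\mathbf{a}}^{\mathfrak{m}}$. Let $\mathbb{F}[\mathcal{D}_{\mathbf{a}}]$ be the left $\mathbb{F}$-vector space of operators spanned by all $\mathcal{D}_{\mathbf{a}}^{\mathfrak{m}}$, with composition $\circ$ as product, and for $F = \sum_{\mathfrak{m}} F_{\mathfrak{m}} \mathfrak{m} \in R$ put $F^{\mathcal{D}_{\mathbf{a}}} = \sum_{\mathfrak{m}} F_{\mathfrak{m}} \mathcal{D}_{\mathbf{a}}^{\mathfrak{m}}$. Let $K_{\mathbf{a}} = \{\beta \in \mathbb{F} : \mathcal{D}_{\mathbf{a}}(\beta) = \mathbf{a}\beta\}$, a division subring of $\mathbb{F}$, let $\mathcal{C}(\mathbf{a}) = \{\mathcal{D}_{\mathbf{a}}(\beta)\beta^{-1} : \beta \in \mathbb{F}\setminus\{0\}\}$, and let $I(\mathcal{C}(\mathbf{a}))$ be the (two-sided) ideal of all $F \in R$ with $F(\mathbf{b})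 = 0$ for all $\mathbf{b} \in \mathcal{C}(\mathbf{a})$, where $F(\mathbf{b})$ is the unique element of $\mathbb{F}$ such that $F - F(\mathbf{b})$ lies in the left ideal $(x_1 - b_1,\ldots,x_n - b_n)$. Suppose that $M = \dim^R_{K_{\mathbf{a}}}(\mathbb{F})$, the dimension of $\mathbb{F}$ as a right vector space over $K_{\mathbf{a}}$, is finite, and let $\boldsymbol\beta = (\beta_1,\ldots,\beta_M)$ be an ordered right basis of $\mathbb{F}$ over $K_{\mathbf{a}}$. For $\mathbf{y} = (y_1,\ldots,y_M) \in \mathbb{F}^M$ let $\mu_{\boldsymbol\beta}(\mathbf{y}) \in K_{\mathbf{a}}^{M \times M}$ be the matrix $(y_j^i)_{i,j}$ determined by $y_j = \sum_{i=1}^M \beta_i y_j^i$, and put $\mathbf{y} \star_{\boldsymbol\beta} \mathbf{z} = \mu_{\boldsymbol\beta}^{-1}(\mu_{\boldsymbol\beta}(\mathbf{y})\mu_{\boldsymbol\beta}(\mathbf{z}))$. Then: 1. $F + I(\mathcal{C}(\mathbf{a})) \mapsto F^{\mathcal{D}_{\mathbf{a}}}$ is a well-defined left $\mathbb{F}$-linear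 ring isomorphism $R/I(\mathcal{C}(\mathbf{a})) \to (\mathbb{F}[\mathcal{D}_{\mathbf{a}}],\circ)$. 2. $E^L_{\boldsymbol\beta} : f \mapsto (f(\beta_1),\ldots,f(\beta_M))$ is a left $\mathbb{F}$-linear ring isomorphism $(\mathbb{F}[\mathcal{D}_{\mathbf{a}}],\circ) \to (\mathbb{F}^M,\star_{\boldsymbol\beta})$. 3. $\mu_{\boldsymbol\beta} : (\mathbb{F}^M,\star_{\boldsymbol\beta}) \to K_{\mathbf{a}}^{M \times M}$ is a ring isomorphism; hence so is $\mu_{\boldsymbol\beta} \circ E^L_{\boldsymbol\beta} : \mathbb{F}[\mathcal{D}_{\mathbf{a}}] \to K_{\mathbf{a}}^{M \times M}$. 4. The ring $R/I(\mathcal{C}(\mathbf{a}))$ is simple: it is non-zero and has no two-sided ideals other than $0$ and itself. -/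

import Mathlib

open scoped Matrix

noncomputable section

/-- A `σ`-derivation `δ : F → Fⁿ`, for a ring morphism `σ : F → F^{n × n}`: an additive map with
`δ (a b) = σ(a) δ(b) + δ(a) b`. -/
structure SkewDerivation {F : Type*} [DivisionRing F] {n : ℕ}
    (σ : F →+* Matrix (Fin n) (Fin n) F) where
  toFun : F → Fin n → F
  map_add' : ∀ a b, toFun (a + b) = toFun a + toFun b
  map_mul' : ∀ a b, toFun (a * b) = σ a *ᵥ toFun b + fun i => toFun a i * b

namespace SkewDerivation

variable {F : Type*} [DivisionRing F] {n : ℕ} {σ : F →+* Matrix (Fin n) (Fin n) F}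

instance : CoeFun (SkewDerivation σ) (fun _ => F → Fin n → F) := ⟨SkewDerivation.toFun⟩

variable (δ : SkewDerivation σ)

theorem map_add (a b : F) : δ (a + b) = δ a + δ b := δ.map_add' a b

theorem map_zero : δ 0 = 0 := by
  have h := δ.map_add 0 0
  simpa using h

theorem map_mul_apply (a b : F) (i : Fin n) :
    δ (a * b) i = ∑ k, σ a i k * δ b k + δ a i * b := by
  rw [δ.map_mul']; simp [Matrix.mulVec, dotProduct]

theorem map_one : δ 1 = 0 := by
  have h := δ.map_mul' 1 1
  simpa using h

end SkewDerivation

section EndApply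

variable {V : Type*} [AddCommGroup V]

theorem addEnd_add_apply (f g : AddMonoid.End V) (v : V) : (f + g) v = f v + g v := rfl

theorem addEnd_sub_apply (f g : AddMonoid.End V) (v : V) : (f - g) v = f v - g v := rfl

theorem addEnd_mul_apply (f g : AddMonoid.End V) (v : V) : (f * g) v = f (g v) := rfl

theorem addEnd_sum_apply {ι : Type*} (s : Finset ι) (f : ι → AddMonoid.End V) (v : V) :
    (∑ i ∈ s, f i) v = ∑ i ∈ s, f i v := by
  classical
  induction s using Finset.induction_on with
  | empty => rfl
  | insert i s hi ih => rw [Finset.sum_insert hi, Finset.sum_insert hi, addEnd_add_apply, ih]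

theorem scalarEnd_apply {R : Type*} [Ring R] [Module R V] (c : R) (v : V) :
    Module.toAddMonoidEnd R V c v = c • v := rfl

end EndApply

/-- The free multivariate skew polynomial ring `F[x; σ, δ]`: the left vector space over `F` with
basis the free monoid on `n` letters; its product is defined below. -/
def SkewPoly {F : Type*} [DivisionRing F] {n : ℕ} {σ : F →+* Matrix (Fin n) (Fin n) F}
    (_δ : SkewDerivation σ) : Type _ :=
  FreeMonoid (Fin n) →₀ F

namespace SkewPoly

variable {F : Type*} [DivisionRing F] {n : ℕ} {σ : F →+* Matrix (Fin n) (Fin n) F}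
  (δ : SkewDerivation σ)

instance : AddCommGroup (SkewPoly δ) := inferInstanceAs (AddCommGroup (FreeMonoid (Fin n) →₀ F))

instance : Module F (SkewPoly δ) := inferInstanceAs (Module F (FreeMonoid (Fin n) →₀ F))

/-- The skew polynomial `c 𝔪`, for a constant `c` and a monomial `𝔪`. -/
def monomial (m : FreeMonoid (Fin n)) : F →+ SkewPoly δ := Finsupp.singleAddHom m

variable {δ} in
theorem induction_on {p : SkewPoly δ → Prop} (G : SkewPoly δ) (zero : p 0)
    (add : ∀ G H, p G → p H → p (G + H)) (mono : ∀ m c, p (monomial δ m c)) : p G :=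
  Finsupp.induction_linear G zero add mono

theorem smul_monomial (c d : F) (m : FreeMonoid (Fin n)) :
    c • monomial δ m d = monomial δ m (c * d) :=
  Finsupp.smul_single c m d

/-- The additive map `∑ c_𝔪 𝔪 ↦ ∑ s(c_𝔪) y_𝔪` into a ring `A`, where `s : F → A` is a ring morphism
and `y_𝔪` is the product of the `y i` along the word `𝔪`. -/
def sumMap {A : Type*} [Ring A] (s : F →+* A) (y : Fin n → A) : SkewPoly δ →+ A :=
  Finsupp.liftAddHom fun m => (AddMonoidHom.mulRight (FreeMonoid.lift y m)).comp s.toAddMonoidHom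

theorem sumMap_monomial {A : Type*} [Ring A] (s : F →+* A) (y : Fin n → A)
    (m : FreeMonoid (Fin n)) (c : F) :
    sumMap δ s y (monomial δ m c) = s c * FreeMonoid.lift y m := by
  unfold sumMap monomial
  exact Finsupp.liftAddHom_apply_single _ _ _

/-- Left multiplication by the variable `x_i`, according to the rule
`x_i (c 𝔪) = ∑ j, σ_{i,j}(c) x_j 𝔪 + δ_i(c) 𝔪`. -/
def varMul (i : Fin n) : AddMonoid.End (SkewPoly δ) :=
  Finsupp.liftAddHom fun m =>
    { toFun := fun c => ∑ j, monomial δ (FreeMonoid.of j * m) (σ c i j) + monomial δ m (δ c i)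
      map_zero' := by simp [δ.map_zero]
      map_add' := fun c d => by
        simp only [_root_.map_add, Matrix.add_apply, δ.map_add, Pi.add_apply,
          Finset.sum_add_distrib]
        abel }

theorem varMul_monomial (i : Fin n) (m : FreeMonoid (Fin n)) (c : F) :
    varMul δ i (monomial δ m c) =
      ∑ j, monomial δ (FreeMonoid.of j * m) (σ c i j) + monomial δ m (δ c i) := by
  unfold varMul
  exact Finsupp.liftAddHom_apply_single _ _ _

/-- Left multiplication by a skew polynomial: `∑ c_𝔪 𝔪` acts as `∑ c_𝔪 (x_{i_1} ∘ ⋯ ∘ x_{i_d})` for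
`𝔪 = x_{i_1} ⋯ x_{i_d}`. -/
def mulHom : SkewPoly δ →+ AddMonoid.End (SkewPoly δ) :=
  sumMap δ (Module.toAddMonoidEnd F (SkewPoly δ)) (varMul δ)

section general

variable {A : Type*} [Ring A] (s : F →+* A) (y : Fin n → A)

theorem sumMap_smul (c : F) (G : SkewPoly δ) : sumMap δ s y (c • G) = s c * sumMap δ s y G := by
  induction G using induction_on with
  | zero => simp
  | add G H hG hH => simp [mul_add, hG, hH]
  | mono m d => simp [smul_monomial, sumMap_monomial, mul_assoc]

theorem sumMap_varMul
    (hy : ∀ i c, y i * s c = ∑ j, s (σ c i j) * y j + s (δ c i)) (i : Fin n) (G : SkewPoly δ) :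
    sumMap δ s y (varMul δ i G) = y i * sumMap δ s y G := by
  induction G using induction_on with
  | zero => simp
  | add G H hG hH => simp [mul_add, hG, hH]
  | mono m d =>
    simp [varMul_monomial, sumMap_monomial, ← mul_assoc, hy, add_mul, Finset.sum_mul]

theorem sumMap_word
    (hy : ∀ i c, y i * s c = ∑ j, s (σ c i j) * y j + s (δ c i)) (m : FreeMonoid (Fin n))
    (G : SkewPoly δ) :
    sumMap δ s y (FreeMonoid.lift (varMul δ) m G) = FreeMonoid.lift y m * sumMap δ s y G := by
  induction m using FreeMonoid.inductionOn' with
  | one => simp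
  | of_mul i m ih => simp [sumMap_varMul δ s y hy, ih, mul_assoc, addEnd_mul_apply]

theorem sumMap_mulHom
    (hy : ∀ i c, y i * s c = ∑ j, s (σ c i j) * y j + s (δ c i)) (G H : SkewPoly δ) :
    sumMap δ s y (mulHom δ G H) = sumMap δ s y G * sumMap δ s y H := by
  induction G using induction_on with
  | zero => simp
  | add G G' hG hG' => simp [add_mul, hG, hG', addEnd_add_apply]
  | mono m d =>
    simp [mulHom, sumMap_monomial, sumMap_smul, sumMap_word δ s y hy, mul_assoc,
      addEnd_mul_apply, scalarEnd_apply]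

end general

theorem varMul_smul (i : Fin n) (c : F) (G : SkewPoly δ) :
    varMul δ i (c • G) = ∑ j, σ c i j • varMul δ j G + δ c i • G := by
  induction G using induction_on with
  | zero => simp
  | add G H hG hH =>
    simp only [smul_add, _root_.map_add, hG, hH, Finset.sum_add_distrib]
    abel
  | mono m d =>
    simp only [smul_monomial, varMul_monomial, _root_.map_mul, Matrix.mul_apply, δ.map_mul_apply,
      smul_add, Finset.smul_sum, _root_.map_sum, _root_.map_add, Finset.sum_add_distrib]
    rw [Finset.sum_comm, add_assoc]

theorem varMul_rule (i : Fin n) (c : F) :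
    varMul δ i * Module.toAddMonoidEnd F (SkewPoly δ) c =
      ∑ j, Module.toAddMonoidEnd F (SkewPoly δ) (σ c i j) * varMul δ j
        + Module.toAddMonoidEnd F (SkewPoly δ) (δ c i) := by
  apply AddMonoid.End.ext
  intro G
  simp [addEnd_mul_apply, addEnd_add_apply, addEnd_sum_apply, scalarEnd_apply, varMul_smul]

instance : Mul (SkewPoly δ) := ⟨fun G H => mulHom δ G H⟩

instance : One (SkewPoly δ) := ⟨monomial δ 1 1⟩

theorem mul_def (G H : SkewPoly δ) : G * H = mulHom δ G H := rfl

theorem one_def : (1 : SkewPoly δ) = monomial δ 1 1 := rfl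

theorem word_one (m : FreeMonoid (Fin n)) :
    FreeMonoid.lift (varMul δ) m (1 : SkewPoly δ) = monomial δ m 1 := by
  induction m using FreeMonoid.inductionOn' with
  | one => rfl
  | of_mul i m ih =>
    simp only [_root_.map_mul, FreeMonoid.lift_eval_of, addEnd_mul_apply, ih,
      varMul_monomial, _root_.map_one, δ.map_one, Pi.zero_apply, _root_.map_zero, add_zero]
    rw [Finset.sum_eq_single i] <;> simp +contextual [eq_comm]

instance : Ring (SkewPoly δ) :=
  { (inferInstance : AddCommGroup (SkewPoly δ)) with
    mul := (· * ·)
    one := 1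
    left_distrib := fun G H K => by simp [mul_def]
    right_distrib := fun G H K => by simp [mul_def, addEnd_add_apply]
    zero_mul := fun G => by simp [mul_def]
    mul_zero := fun G => by simp [mul_def]
    mul_assoc := fun G H K => by
      have h := sumMap_mulHom δ (Module.toAddMonoidEnd F (SkewPoly δ)) (varMul δ)
        (varMul_rule δ) G H
      exact DFunLike.congr_fun h K
    one_mul := fun G => by simp [mul_def, one_def, mulHom, sumMap_monomial]
    mul_one := fun G => by
      change mulHom δ G 1 = G
      induction G using induction_on with
      | zero => simp
      | add G H hG hH => simp [addEnd_add_apply, hG, hH]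
      | mono m d =>
        simp [mulHom, sumMap_monomial, word_one, smul_monomial, addEnd_mul_apply,
          scalarEnd_apply] }

instance : IsScalarTower F (SkewPoly δ) (SkewPoly δ) :=
  ⟨fun c G H => by
    simp [mul_def, mulHom, sumMap_smul, addEnd_mul_apply, scalarEnd_apply]⟩

/-- The variable `x_i`. -/
def X (i : Fin n) : SkewPoly δ := monomial δ (FreeMonoid.of i) 1

/-- The constant skew polynomial `c`. -/
def C (c : F) : SkewPoly δ := monomial δ 1 c

theorem smul_one_eq (c : F) : c • (1 : SkewPoly δ) = C δ c := by
  simp [one_def, C, smul_monomial]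

theorem C_mul (c : F) (G : SkewPoly δ) : C δ c * G = c • G := by
  rw [← smul_one_eq, smul_mul_assoc, one_mul]

theorem X_mul (i : Fin n) (G : SkewPoly δ) : X δ i * G = varMul δ i G := by
  simp [X, mul_def, mulHom, sumMap_monomial]

/-- Products of monomials are given by appending them. -/
theorem monomial_mul_monomial (m m' : FreeMonoid (Fin n)) :
    monomial δ m 1 * monomial δ m' 1 = monomial δ (m * m') 1 := by
  simp only [← word_one δ m', ← word_one δ (m * m'), _root_.map_mul, addEnd_mul_apply]
  simp [mul_def, mulHom, sumMap_monomial]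

/-- The defining commutation rule `x_i c = ∑ j, σ_{i,j}(c) x_j + δ_i(c)`. -/
theorem X_mul_C (i : Fin n) (c : F) :
    X δ i * C δ c = ∑ j, C δ (σ c i j) * X δ j + C δ (δ c i) := by
  simp only [C_mul, X_mul]
  simp [C, varMul_monomial, X, smul_monomial]

/-- The operators `𝒟_a^{x_i} : F → F`, the components of `𝒟_a(β) = σ(β) a + δ(β)`. -/
def opD (a : Fin n → F) (i : Fin n) : AddMonoid.End F where
  toFun b := (σ b *ᵥ a + δ b) i
  map_zero' := by simp [δ.map_zero]
  map_add' b c := by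
    simp only [_root_.map_add, δ.map_add, Matrix.add_mulVec, Pi.add_apply]
    abel

theorem opD_apply (a : Fin n → F) (i : Fin n) (b : F) :
    opD δ a i b = ∑ j, σ b i j * a j + δ b i := rfl

/-- The operator `𝒟_a^𝔪`, with `𝒟_a^1 = Id` and `𝒟_a^{x_i 𝔪} = 𝒟_a^{x_i} ∘ 𝒟_a^𝔪`. The product in
`AddMonoid.End F` is composition of maps. -/
def opWord (a : Fin n → F) : FreeMonoid (Fin n) →* AddMonoid.End F := FreeMonoid.lift (opD δ a)

/-- The map `φ_a`, sending `∑ c_𝔪 𝔪` to the operator `β ↦ ∑ c_𝔪 𝒟_a^𝔪(β)`. -/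
def linearize (a : Fin n → F) : SkewPoly δ →+ AddMonoid.End F :=
  sumMap δ (Module.toAddMonoidEnd F F) (opD δ a)

theorem linearize_monomial (a : Fin n → F) (m : FreeMonoid (Fin n)) (c b : F) :
    linearize δ a (monomial δ m c) b = c * opWord δ a m b := by
  simp [linearize, sumMap_monomial, opWord, addEnd_mul_apply, scalarEnd_apply]

theorem linearize_apply (a : Fin n → F) (G : SkewPoly δ) (b : F) :
    linearize δ a G b = Finsupp.sum G fun m c => c * opWord δ a m b := by
  induction G using induction_on with
  | zero => exact (Finsupp.sum_zero_index).symm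
  | add G H hG hH =>
    rw [_root_.map_add, addEnd_add_apply, hG, hH]
    exact (Finsupp.sum_add_index' (by simp) (by simp [add_mul])).symm
  | mono m c =>
    rw [linearize_monomial]
    exact (Finsupp.sum_single_index (h := fun m c => c * opWord δ a m b) (zero_mul _)).symm

theorem opD_mul (a : Fin n → F) (i : Fin n) (c b : F) :
    opD δ a i (c * b) = ∑ j, σ c i j * opD δ a j b + δ c i * b := by
  simp only [opD_apply, _root_.map_mul, Matrix.mul_apply, δ.map_mul_apply, mul_add,
    Finset.sum_add_distrib, Finset.mul_sum, Finset.sum_mul]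
  rw [Finset.sum_comm, add_assoc]
  simp [mul_assoc]

theorem linearize_mul (a : Fin n → F) (G H : SkewPoly δ) :
    linearize δ a (G * H) = linearize δ a G * linearize δ a H := by
  refine sumMap_mulHom δ _ _ (fun i c => ?_) G H
  apply AddMonoid.End.ext
  intro b
  simp [addEnd_mul_apply, addEnd_add_apply, addEnd_sum_apply, scalarEnd_apply, opD_mul]

theorem linearize_C (a : Fin n → F) (c b : F) : linearize δ a (C δ c) b = c * b := by
  simp [C, linearize_monomial]

theorem linearize_X (a : Fin n → F) (i : Fin n) : linearize δ a (X δ i) = opD δ a i := by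
  apply AddMonoid.End.ext
  intro b
  rw [X, linearize_monomial]
  simp [opWord]

/-- The left ideal `(x_1 - a_1, …, x_n - a_n)`. -/
def pointIdeal (a : Fin n → F) : Ideal (SkewPoly δ) :=
  Ideal.span (Set.range fun i => X δ i - C δ (a i))

theorem opD_one (a : Fin n → F) (i : Fin n) : opD δ a i 1 = a i := by
  simp [opD_apply, δ.map_one, Matrix.one_apply]

theorem linearize_one_of_mem (a : Fin n → F) {G : SkewPoly δ} (hG : G ∈ pointIdeal δ a) :
    linearize δ a G 1 = 0 := by
  induction hG using Submodule.span_induction with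
  | mem x hx =>
    obtain ⟨i, rfl⟩ := hx
    simp [linearize_X, linearize_C, opD_one, addEnd_sub_apply]
  | zero => simp
  | add x y _ _ hx hy => simp [hx, hy, addEnd_add_apply]
  | smul r x _ hx => simp [linearize_mul, hx, addEnd_mul_apply]

theorem smul_mem_of_mem {I : Ideal (SkewPoly δ)} (c : F) {G : SkewPoly δ} (hG : G ∈ I) :
    c • G ∈ I := by
  rw [← C_mul]; exact I.mul_mem_left _ hG

theorem sub_linearize_word_mem (a : Fin n → F) (m : FreeMonoid (Fin n)) :
    monomial δ m 1 - C δ (opWord δ a m 1) ∈ pointIdeal δ a := by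
  induction m using FreeMonoid.inductionOn' with
  | one => simp [C]
  | of_mul i m ih =>
    set b := opWord δ a m 1 with hb
    have e1 : monomial δ (FreeMonoid.of i * m) 1 = X δ i * monomial δ m 1 :=
      (monomial_mul_monomial δ _ _).symm
    have e2 : opWord δ a (FreeMonoid.of i * m) 1 = opD δ a i b := by simp [hb, opWord]
    have e3 : monomial δ (FreeMonoid.of i * m) 1 - C δ (opD δ a i b) =
        X δ i * (monomial δ m 1 - C δ b) + ∑ j, σ b i j • (X δ j - C δ (a j)) := by
      rw [e1, mul_sub, X_mul_C, opD_apply]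
      simp only [C, _root_.map_add, _root_.map_sum, smul_sub, smul_monomial,
        Finset.sum_sub_distrib]
      simp only [← C.eq_def, C_mul]
      abel
    rw [e2, e3]
    exact add_mem (Ideal.mul_mem_left _ _ ih) (sum_mem fun j _ =>
      smul_mem_of_mem δ _ (Ideal.subset_span ⟨j, rfl⟩))

theorem sub_linearize_mem (a : Fin n → F) (G : SkewPoly δ) :
    G - C δ (linearize δ a G 1) ∈ pointIdeal δ a := by
  induction G using induction_on with
  | zero => simp [C]
  | add G H hG hH =>
    have h := add_mem hG hH
    convert h using 1
    simp only [C, _root_.map_add, addEnd_add_apply]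
    abel
  | mono m c =>
    have h := smul_mem_of_mem δ c (sub_linearize_word_mem δ a m)
    simpa [linearize_monomial, smul_sub, C, smul_monomial] using h

theorem existsUnique_eval (a : Fin n → F) (G : SkewPoly δ) :
    ∃! b : F, G - C δ b ∈ pointIdeal δ a := by
  refine ⟨_, sub_linearize_mem δ a G, fun b hb => ?_⟩
  have h := linearize_one_of_mem δ a hb
  simp [linearize_C, sub_eq_zero, addEnd_sub_apply] at h
  exact h.symm

/-- The skew evaluation `G(a)`: the unique `b ∈ F` with `G - b ∈ (x_1 - a_1, …, x_n - a_n)`. -/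
def eval (a : Fin n → F) (G : SkewPoly δ) : F := (existsUnique_eval δ a G).choose

theorem eval_eq_linearize (a : Fin n → F) (G : SkewPoly δ) :
    eval δ a G = linearize δ a G 1 :=
  (existsUnique_eval δ a G).unique (existsUnique_eval δ a G).choose_spec.1
    (sub_linearize_mem δ a G)

/-- The left ideal `I(Ω)` of skew polynomials vanishing at all points of `Ω`. -/
def vanishingIdeal (Ω : Set (Fin n → F)) : Ideal (SkewPoly δ) where
  carrier := {G | ∀ a ∈ Ω, eval δ a G = 0}
  zero_mem' a _ := by simp [eval_eq_linearize]
  add_mem' hG hH a ha := by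
    have h1 := hG a ha
    have h2 := hH a ha
    simp only [eval_eq_linearize] at h1 h2 ⊢
    simp [h1, h2, addEnd_add_apply]
  smul_mem' G H hH a ha := by
    have h2 := hH a ha
    simp only [eval_eq_linearize] at h2 ⊢
    simp [linearize_mul, h2, addEnd_mul_apply]

/-- The conjugate `a^b = 𝒟_a(b) b⁻¹`. -/
def conj (a : Fin n → F) (b : F) : Fin n → F := fun i => opD δ a i b * b⁻¹

/-- The conjugacy class `𝒞(a) = {𝒟_a(b) b⁻¹ | b ∈ F*}`. -/
def conjClass (a : Fin n → F) : Set (Fin n → F) := {c | ∃ b : F, b ≠ 0 ∧ c = conj δ a b}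

theorem opD_conj (a : Fin n → F) {b : F} (hb : b ≠ 0) (i : Fin n) (c : F) :
    opD δ (conj δ a b) i c * b = opD δ a i (c * b) := by
  rw [opD_mul, opD_apply, add_mul, Finset.sum_mul]
  simp [conj, mul_assoc, hb]

theorem linearize_conj (a : Fin n → F) {b : F} (hb : b ≠ 0) (G : SkewPoly δ) (c : F) :
    linearize δ (conj δ a b) G c * b = linearize δ a G (c * b) := by
  have hw : ∀ m, opWord δ (conj δ a b) m c * b = opWord δ a m (c * b) := by
    intro m
    induction m using FreeMonoid.inductionOn' with
    | one => simp
    | of_mul i m ih =>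
      have h := opD_conj δ a hb i (opWord δ (conj δ a b) m c)
      simp only [opWord, _root_.map_mul, FreeMonoid.lift_eval_of, addEnd_mul_apply] at *
      rw [h, ih]
  simp only [linearize_apply, Finsupp.sum, Finset.sum_mul, mul_assoc, hw]

theorem mem_vanishingIdeal_conjClass (a : Fin n → F) (G : SkewPoly δ) :
    G ∈ vanishingIdeal δ (conjClass δ a) ↔ linearize δ a G = 0 := by
  constructor
  · intro h
    apply AddMonoid.End.ext
    intro b
    by_cases hb : b = 0
    · simp [hb]
    · have h1 := h _ ⟨b, hb, rfl⟩
      rw [eval_eq_linearize] at h1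
      have h2 := linearize_conj δ a hb G 1
      rw [h1, zero_mul, one_mul] at h2
      simpa using h2.symm
  · rintro h _ ⟨b, hb, rfl⟩
    have h2 := linearize_conj δ a hb G 1
    rw [h] at h2
    rw [eval_eq_linearize]
    simpa [hb] using h2

/-- `I(𝒞(a))` is a two-sided ideal, so that the quotient by it is a ring. -/
instance (a : Fin n → F) : (vanishingIdeal δ (conjClass δ a)).IsTwoSided :=
  ⟨fun H hG => by
    rw [mem_vanishingIdeal_conjClass] at *
    rw [linearize_mul, hG, zero_mul]⟩

theorem linearize_mem_span (a : Fin n → F) (G : SkewPoly δ) :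
    linearize δ a G ∈ Submodule.span F (Set.range (opWord δ a)) := by
  induction G using induction_on with
  | zero => simp
  | add G H hG hH => rw [_root_.map_add]; exact add_mem hG hH
  | mono m c =>
    have h : linearize δ a (monomial δ m c) = c • opWord δ a m := by
      apply AddMonoid.End.ext
      intro b
      rw [linearize_monomial]; rfl
    rw [h]
    exact Submodule.smul_mem _ _ (Submodule.subset_span ⟨m, rfl⟩)

theorem linearize_smul (a : Fin n → F) (c : F) (G : SkewPoly δ) :
    linearize δ a (c • G) = c • linearize δ a G := by
  rw [linearize, sumMap_smul]; rfl

theorem exists_linearize_of_mem_span (a : Fin n → F) {f : AddMonoid.End F}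
    (hf : f ∈ Submodule.span F (Set.range (opWord δ a))) : ∃ G, linearize δ a G = f := by
  induction hf using Submodule.span_induction with
  | mem f hf =>
    obtain ⟨m, rfl⟩ := hf
    refine ⟨monomial δ m 1, ?_⟩
    apply AddMonoid.End.ext
    intro b
    simp [linearize_monomial]
  | zero => exact ⟨0, by simp⟩
  | add f g _ _ hf hg =>
    obtain ⟨G, rfl⟩ := hf
    obtain ⟨H, rfl⟩ := hg
    exact ⟨G + H, by simp⟩
  | smul c f _ hf =>
    obtain ⟨G, rfl⟩ := hf
    exact ⟨c • G, linearize_smul δ a c G⟩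

/-- The ring `F[𝒟_a]` of linearized polynomials: the left vector space over `F` generated by the
operators `𝒟_a^𝔪`, with composition as product. -/
def linPoly (a : Fin n → F) : Subring (AddMonoid.End F) where
  carrier := Submodule.span F (Set.range (opWord δ a))
  zero_mem' := Submodule.zero_mem _
  add_mem' := Submodule.add_mem _
  neg_mem' := Submodule.neg_mem _
  one_mem' := Submodule.subset_span ⟨1, _root_.map_one _⟩
  mul_mem' {f g} hf hg := by
    obtain ⟨G, rfl⟩ := exists_linearize_of_mem_span δ a hf
    obtain ⟨H, rfl⟩ := exists_linearize_of_mem_span δ a hg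
    rw [← linearize_mul]
    exact linearize_mem_span δ a _

instance (a : Fin n → F) : Module F (linPoly δ a) :=
  inferInstanceAs (Module F (Submodule.span F (Set.range (opWord δ a))))

/-- `F[𝒟_a]` is a left `F`-algebra. -/
instance (a : Fin n → F) : IsScalarTower F (linPoly δ a) (linPoly δ a) := ⟨fun _ _ _ => rfl⟩

/-- `F[x; σ, δ] / I(𝒞(a))` is a left `F`-algebra. -/
instance (a : Fin n → F) :
    IsScalarTower F (SkewPoly δ ⧸ vanishingIdeal δ (conjClass δ a))
      (SkewPoly δ ⧸ vanishingIdeal δ (conjClass δ a)) :=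
  ⟨fun c x y => by
    obtain ⟨G, rfl⟩ := Ideal.Quotient.mk_surjective x
    obtain ⟨H, rfl⟩ := Ideal.Quotient.mk_surjective y
    exact congrArg (Ideal.Quotient.mk (vanishingIdeal δ (conjClass δ a)))
      (smul_mul_assoc c G H)⟩

/-- The centralizer `K_a = {β ∈ F | 𝒟_a(β) = a β}`, a division subring of `F`. -/
def centralizer (a : Fin n → F) : Subfield F :=
  have key : ∀ {c b : F}, (∀ i, opD δ a i b = a i * b) → ∀ i,
      opD δ a i (c * b) = opD δ a i c * b := by
    intro c b hb i
    rw [opD_mul, opD_apply, add_mul, Finset.sum_mul]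
    simp [hb, mul_assoc]
  { carrier := {b | ∀ i, opD δ a i b = a i * b}
    zero_mem' := fun i => by simp
    one_mem' := fun i => by simp [opD_one]
    add_mem' := fun hb hc i => by simp [hb i, hc i, mul_add]
    neg_mem' := fun hb i => by simp [hb i]
    mul_mem' := fun hb hc i => by rw [key hc, hb i, mul_assoc]
    inv_mem' := fun b hb i => by
      by_cases h0 : b = 0
      · simp [h0]
      · have h := key (c := b⁻¹) hb i
        rw [inv_mul_cancel₀ h0, opD_one] at h
        rw [h, mul_assoc, mul_inv_cancel₀ h0, mul_one] }

end SkewPoly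

section MatrixProduct

variable {F : Type*} [DivisionRing F] {K : Subfield F} {M : ℕ}

/-- `F` as a right vector space over a division subring `K`: `c ∈ K` acts by `x ↦ x c`. -/
instance Subfield.rightModule {F : Type*} [DivisionRing F] (K : Subfield F) : Module (Kᵐᵒᵖ) F :=
  Module.compHom F (K.subtype.op)

/-- The matrix-representation map `μ_β : F^M → K^{M × M}` of an ordered right basis `β`: the `j`-th
column of `μ_β(x)` consists of the coordinates of `x_j`, that is, `x_j = ∑ i, β_i μ_β(x)_{i,j}`. -/
def matRep (β : Module.Basis (Fin M) (Kᵐᵒᵖ) F) : (Fin M → F) ≃+ Matrix (Fin M) (Fin M) K where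
  toFun x := Matrix.of fun i j => (β.repr (x j) i).unop
  invFun A := fun j => ∑ i, β i * (A i j : F)
  left_inv x := by
    funext j
    exact β.sum_repr (x j)
  right_inv A := by
    ext i j
    have h : ∑ k, β k * (A k j : F) = ∑ k, MulOpposite.op (A k j) • β k := rfl
    simp only [Matrix.of_apply, h, β.repr_sum_self]
    simp
  map_add' x y := by
    ext i j
    simp

/-- The vectors `F^M`, to be equipped with the matrix product with respect to `β`. -/
def MatVec (_β : Module.Basis (Fin M) (Kᵐᵒᵖ) F) : Type _ := Fin M → F

namespace MatVec

variable (β : Module.Basis (Fin M) (Kᵐᵒᵖ) F)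

instance : AddCommGroup (MatVec β) := inferInstanceAs (AddCommGroup (Fin M → F))

instance : Module F (MatVec β) := inferInstanceAs (Module F (Fin M → F))

/-- The matrix-representation map, on `MatVec β`. -/
def toMatrix : MatVec β ≃+ Matrix (Fin M) (Fin M) K := matRep β

/-- The matrix product `x ⋆ y = μ_β⁻¹(μ_β(x) μ_β(y))`. -/
instance : Mul (MatVec β) := ⟨fun x y => (toMatrix β).symm (toMatrix β x * toMatrix β y)⟩

instance : One (MatVec β) := ⟨(toMatrix β).symm 1⟩

theorem mul_def (x y : MatVec β) :
    x * y = (toMatrix β).symm (toMatrix β x * toMatrix β y) := rfl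

theorem one_def : (1 : MatVec β) = (toMatrix β).symm 1 := rfl

instance : Ring (MatVec β) :=
  { (inferInstance : AddCommGroup (MatVec β)) with
    mul := (· * ·)
    one := 1
    left_distrib := fun x y z => by simp [mul_def, mul_add]
    right_distrib := fun x y z => by simp [mul_def, add_mul]
    zero_mul := fun x => by simp [mul_def]
    mul_zero := fun x => by simp [mul_def]
    mul_assoc := fun x y z => by simp [mul_def, mul_assoc]
    one_mul := fun x => by simp [mul_def, one_def]
    mul_one := fun x => by simp [mul_def, one_def] }

theorem mul_apply (x y : MatVec β) (j : Fin M) :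
    (x * y) j = ∑ k, x k * (toMatrix β y k j : F) := by
  have hx : ∀ k, x k = ∑ i, β i * (toMatrix β x i k : F) := fun k =>
    (congrFun ((matRep β).symm_apply_apply x) k).symm
  have h : (x * y) j = ∑ i, β i * (((toMatrix β x * toMatrix β y) i j : K) : F) := rfl
  rw [h]
  simp only [hx, Matrix.mul_apply, Finset.sum_mul]
  rw [Finset.sum_comm]
  simp [Finset.mul_sum, mul_assoc]

/-- `F^M` with the matrix product is a left `F`-algebra. -/
instance : IsScalarTower F (MatVec β) (MatVec β) :=
  ⟨fun c x y => by
    funext j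
    have h : ∀ (z : MatVec β) (k : Fin M), (c • z) k = c * z k := fun _ _ => rfl
    simp [h, mul_apply, Finset.mul_sum, mul_assoc]⟩

end MatVec

end MatrixProduct

/-- The linearized evaluation map `E^L_β : F[𝒟_a] → F^M`, `f ↦ (f(β_1), …, f(β_M))`. -/
def SkewPoly.linEval {F : Type*} [DivisionRing F] {n : ℕ} {σ : F →+* Matrix (Fin n) (Fin n) F}
    (δ : SkewDerivation σ) (a : Fin n → F) {M : ℕ}
    (β : Module.Basis (Fin M) (SkewPoly.centralizer δ a)ᵐᵒᵖ F)
    (f : SkewPoly.linPoly δ a) : MatVec β :=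
  fun j => (f : AddMonoid.End F) (β j)

end

/-!
The quotient by `I(𝒞(a))` is the image of `F[x; σ, δ]` under `G ↦ G^{𝒟_a}`, because evaluating `G`
at the conjugate `𝒟_a(b) b⁻¹` amounts to computing `G^{𝒟_a}(b) b⁻¹`.

The operators in `F[𝒟_a]` include all left multiplications. Hence `F` is a simple `F[𝒟_a]`-module,
and an additive map commuting with `F[𝒟_a]` is right multiplication by the image of `1`, which lies
in `K_a` as soon as the map commutes with the `𝒟_a^{x_i}`. By Jacobson's density theorem `F[𝒟_a]` is
then dense in the right `K_a`-linear endomorphisms of `F`, so it is all of them when `F` is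
finite-dimensional over `K_a`. A basis turns these endomorphisms into the matrices over the division
ring `K_a`, which form a simple ring.
-/

section Density

theorem exists_mem_eqOn_of_mem_centralizer_centralizer {A : Type*} [AddCommGroup A]
    {S : Subring (AddMonoid.End A)} [IsSemisimpleModule S A] {h : AddMonoid.End A}
    (hh : h ∈ Subring.centralizer (Subring.centralizer (S : Set (AddMonoid.End A)) : Set _))
    (s : Finset A) : ∃ f ∈ S, Set.EqOn f h s := by
  have map_commute (g : Module.End S A) (v : A) : g (h v) = h (g v) :=
    DFunLike.congr_fun (Subring.mem_centralizer_iff.1 hh g.toAddMonoidHom <|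
      Subring.mem_centralizer_iff.2 fun f hf =>
        AddMonoid.End.ext _ fun w => (g.map_smul ⟨f, hf⟩ w).symm) v
  let h' : Module.End (Module.End S A) A :=
    { h with map_smul' := fun g v => (map_commute g v).symm }
  obtain ⟨f, hf⟩ := jacobson_density (R := S) h' s
  exact ⟨f, f.2, fun v hv => (hf v hv).symm⟩

theorem eq_mulRight_of_forall_commute_mulLeft {R : Type*} [NonAssocSemiring R]
    {g : AddMonoid.End R}
    (hg : ∀ c, Commute (AddMonoid.End.mulLeft c) g) : g = AddMonoid.End.mulRight (g 1) :=
  AddMonoid.End.ext _ fun v =>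
    calc g v = (g * AddMonoid.End.mulLeft v) 1 := congrArg g (mul_one v).symm
      _ = v * g 1 := DFunLike.congr_fun (hg v).symm 1

theorem isSimpleModule_of_mulLeft_mem {D : Type*} [DivisionRing D]
    {S : Subring (AddMonoid.End D)} (hS : ∀ c, AddMonoid.End.mulLeft c ∈ S) : IsSimpleModule S D :=
  isSimpleModule_iff_toSpanSingleton_surjective.2 ⟨inferInstance, fun v hv w =>
    ⟨⟨AddMonoid.End.mulLeft (w * v⁻¹), hS _⟩, inv_mul_cancel_right₀ hv w⟩⟩

end Density

namespace SkewPoly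

variable {F : Type*} [DivisionRing F] {n : ℕ} {σ : F →+* Matrix (Fin n) (Fin n) F}
  (δ : SkewDerivation σ) (a : Fin n → F)

/-- The ring morphism `G ↦ G^{𝒟_a}` from `F[x; σ, δ]` to `F[𝒟_a]`. -/
noncomputable def linearizeHom : SkewPoly δ →+* linPoly δ a where
  toFun G := ⟨linearize δ a G, linearize_mem_span δ a G⟩
  map_zero' := Subtype.ext (_root_.map_zero _)
  map_one' := Subtype.ext <| AddMonoid.End.ext _ fun b => by
    simpa [C, one_def] using linearize_C δ a 1 b
  map_add' G H := Subtype.ext (_root_.map_add _ G H)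
  map_mul' G H := Subtype.ext (linearize_mul δ a G H)

theorem linearizeHom_surjective : Function.Surjective (linearizeHom δ a) := fun f =>
  (exists_linearize_of_mem_span δ a f.2).imp fun _ h => Subtype.ext h

theorem ker_linearizeHom :
    RingHom.ker (linearizeHom δ a) = vanishingIdeal δ (conjClass δ a) := by
  ext G
  rw [mem_vanishingIdeal_conjClass, RingHom.mem_ker, Subtype.ext_iff]
  rfl

/-- The isomorphism `F[x; σ, δ] / I(𝒞(a)) ≃ F[𝒟_a]` induced by `G ↦ G^{𝒟_a}`. -/
noncomputable def quotientEquivLinPoly :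
    (SkewPoly δ ⧸ vanishingIdeal δ (conjClass δ a)) ≃+* linPoly δ a :=
  (Ideal.quotEquivOfEq (ker_linearizeHom δ a).symm).trans
    (RingHom.quotientKerEquivOfSurjective (linearizeHom_surjective δ a))

theorem quotientEquivLinPoly_smul (c : F)
    (x : SkewPoly δ ⧸ vanishingIdeal δ (conjClass δ a)) :
    quotientEquivLinPoly δ a (c • x) = c • quotientEquivLinPoly δ a x := by
  obtain ⟨G, rfl⟩ := Ideal.Quotient.mk_surjective x
  exact Subtype.ext (linearize_smul δ a c G)

theorem mulLeft_mem_linPoly (c : F) : AddMonoid.End.mulLeft c ∈ linPoly δ a := by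
  have h : linearize δ a (C δ c) = AddMonoid.End.mulLeft c :=
    AddMonoid.End.ext _ (linearize_C δ a c)
  exact h ▸ linearize_mem_span δ a (C δ c)

theorem opD_mem_linPoly (i : Fin n) : opD δ a i ∈ linPoly δ a :=
  linearize_X δ a i ▸ linearize_mem_span δ a (X δ i)

instance : IsSimpleModule (linPoly δ a) F :=
  isSimpleModule_of_mulLeft_mem (mulLeft_mem_linPoly δ a)

variable {δ a}

theorem conj_eq_self_iff {b : F} (hb : b ≠ 0) : conj δ a b = a ↔ b ∈ centralizer δ a :=
  funext_iff.trans <| forall_congr' fun _ => mul_inv_eq_iff_eq_mul₀ hb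

theorem linPoly_apply_mul {f : AddMonoid.End F} (hf : f ∈ linPoly δ a) (v : F) {k : F}
    (hk : k ∈ centralizer δ a) : f (v * k) = f v * k := by
  obtain ⟨G, rfl⟩ := exists_linearize_of_mem_span δ a hf
  obtain rfl | hk0 := eq_or_ne k 0
  · simp
  · rw [← linearize_conj δ a hk0, (conj_eq_self_iff hk0).2 hk]

theorem mem_centralizer_linPoly_iff {g : AddMonoid.End F} :
    g ∈ Subring.centralizer (linPoly δ a : Set (AddMonoid.End F)) ↔
      ∃ k ∈ centralizer δ a, AddMonoid.End.mulRight k = g := by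
  simp only [Subring.mem_centralizer_iff]
  constructor
  · intro hg
    have g_eq : g = AddMonoid.End.mulRight (g 1) :=
      eq_mulRight_of_forall_commute_mulLeft fun c => hg _ (mulLeft_mem_linPoly δ a c)
    refine ⟨g 1, fun i => ?_, g_eq.symm⟩
    calc opD δ a i (g 1) = g (opD δ a i 1) := DFunLike.congr_fun (hg _ (opD_mem_linPoly δ a i)) 1
      _ = g (a i) := by rw [opD_one]
      _ = a i * g 1 := DFunLike.congr_fun g_eq (a i)
  · rintro ⟨k, hk, rfl⟩ f hf
    exact AddMonoid.End.ext _ fun v => linPoly_apply_mul hf v hk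

theorem mem_centralizer_centralizer_linPoly {g : AddMonoid.End F}
    (hg : ∀ v, ∀ k ∈ centralizer δ a, g (v * k) = g v * k) :
    g ∈ Subring.centralizer
      (Subring.centralizer (linPoly δ a : Set (AddMonoid.End F)) : Set (AddMonoid.End F)) := by
  refine Subring.mem_centralizer_iff.2 fun r hr => ?_
  obtain ⟨k, hk, rfl⟩ := mem_centralizer_linPoly_iff.1 hr
  exact AddMonoid.End.ext _ fun v => (hg v k hk).symm

variable (δ a)

/-- The inclusion of `F[𝒟_a]` into the ring of right `K_a`-linear endomorphisms of `F`. -/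
def linPolyToEnd : linPoly δ a →+* Module.End (centralizer δ a)ᵐᵒᵖ F where
  toFun f :=
    { (f : AddMonoid.End F) with
      map_smul' := fun k v => linPoly_apply_mul f.2 v k.unop.2 }
  map_zero' := rfl
  map_one' := rfl
  map_add' _ _ := rfl
  map_mul' _ _ := rfl

theorem linPolyToEnd_injective : Function.Injective (linPolyToEnd δ a) := fun _ _ h =>
  Subtype.ext <| AddMonoid.End.ext _ fun v => DFunLike.congr_fun h v

theorem linPolyToEnd_surjective [Module.Finite (centralizer δ a)ᵐᵒᵖ F] :
    Function.Surjective (linPolyToEnd δ a) := by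
  intro h
  have map_mul_right (v k : F) (hk : k ∈ centralizer δ a) : h (v * k) = h v * k :=
    h.map_smul (MulOpposite.op ⟨k, hk⟩) v
  obtain ⟨s, hs⟩ := Module.Finite.fg_top (R := (centralizer δ a)ᵐᵒᵖ) (M := F)
  obtain ⟨f, hf, hfs⟩ := exists_mem_eqOn_of_mem_centralizer_centralizer
    (mem_centralizer_centralizer_linPoly (g := h.toAddMonoidHom) map_mul_right) s
  exact ⟨⟨f, hf⟩, LinearMap.ext_on hs hfs⟩

/-- The identification of `F[𝒟_a]` with the right `K_a`-linear endomorphisms of `F`, when `F` is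
finite-dimensional over `K_a`. -/
noncomputable def linPolyEquivEnd [Module.Finite (centralizer δ a)ᵐᵒᵖ F] :
    linPoly δ a ≃+* Module.End (centralizer δ a)ᵐᵒᵖ F :=
  RingEquiv.ofBijective (linPolyToEnd δ a)
    ⟨linPolyToEnd_injective δ a, linPolyToEnd_surjective δ a⟩

end SkewPoly

namespace MatVec

variable {F : Type*} [DivisionRing F] {K : Subfield F} {M : ℕ}
  (β : Module.Basis (Fin M) Kᵐᵒᵖ F)

theorem sum_basis_mul_toMatrix (x : MatVec β) (j : Fin M) :
    ∑ i, β i * (toMatrix β x i j : F) = x j :=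
  congrFun ((matRep β).symm_apply_apply x) j

/-- The isomorphism of the right `K`-linear endomorphisms of `F` with `(F^M, ⋆)` given by the values
on the basis `β`. -/
noncomputable def endEquiv : Module.End Kᵐᵒᵖ F ≃+* MatVec β where
  toEquiv := (β.constr ℕ).symm.toEquiv
  map_add' _ _ := rfl
  map_mul' f g := by
    funext j
    let x : MatVec β := fun k => f (β k)
    let y : MatVec β := fun k => g (β k)
    calc f (y j) = f (∑ i, β i * (toMatrix β y i j : F)) := by rw [sum_basis_mul_toMatrix]
      _ = ∑ i, x i * (toMatrix β y i j : F) := by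
          rw [_root_.map_sum]
          exact Finset.sum_congr rfl fun i _ => f.map_smul (MulOpposite.op _) (β i)
      _ = (x * y) j := (mul_apply β x y j).symm

/-- The ring isomorphism `μ_β` from `(F^M, ⋆)` to `K^{M × M}`. -/
noncomputable def toMatrixEquiv : MatVec β ≃+* Matrix (Fin M) (Fin M) K where
  toEquiv := (toMatrix β).toEquiv
  map_add' := _root_.map_add (toMatrix β)
  map_mul' _ _ := (toMatrix β).apply_symm_apply _

end MatVec

theorem mainTheorem5 {F : Type*} [DivisionRing F] {n : ℕ}
    (σ : F →+* Matrix (Fin n) (Fin n) F) (δ : SkewDerivation σ) (a : Fin n → F) {M : ℕ}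
    (β : Module.Basis (Fin M) (SkewPoly.centralizer δ a)ᵐᵒᵖ F) :
    (∃ (φ : (SkewPoly δ ⧸ SkewPoly.vanishingIdeal δ (SkewPoly.conjClass δ a)) ≃+*
          SkewPoly.linPoly δ a)
        (E : SkewPoly.linPoly δ a ≃+* MatVec β)
        (μ : MatVec β ≃+* Matrix (Fin M) (Fin M) (SkewPoly.centralizer δ a)),
      (∀ G : SkewPoly δ,
        (φ (Ideal.Quotient.mk (SkewPoly.vanishingIdeal δ (SkewPoly.conjClass δ a)) G) :
          AddMonoid.End F) = SkewPoly.linearize δ a G) ∧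
      (∀ (c : F) (x : SkewPoly δ ⧸ SkewPoly.vanishingIdeal δ (SkewPoly.conjClass δ a)),
        φ (c • x) = c • φ x) ∧
      (∀ f : SkewPoly.linPoly δ a, E f = SkewPoly.linEval δ a β f) ∧
      (∀ (c : F) (f : SkewPoly.linPoly δ a), E (c • f) = c • E f) ∧
      (∀ x : MatVec β, μ x = matRep β x) ∧
      (∀ f : SkewPoly.linPoly δ a,
        (E.trans μ) f = matRep β (SkewPoly.linEval δ a β f))) ∧
    IsSimpleRing (SkewPoly δ ⧸ SkewPoly.vanishingIdeal δ (SkewPoly.conjClass δ a)) := by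
  have : Module.Finite (SkewPoly.centralizer δ a)ᵐᵒᵖ F := .of_basis β
  let φ := SkewPoly.quotientEquivLinPoly δ a
  let E := (SkewPoly.linPolyEquivEnd δ a).trans (MatVec.endEquiv β)
  let μ := MatVec.toMatrixEquiv β
  refine ⟨⟨φ, E, μ, fun _ => rfl, SkewPoly.quotientEquivLinPoly_smul δ a, fun _ => rfl,
    fun _ _ => rfl, fun _ => rfl, fun _ => rfl⟩, ?_⟩
  have : Nonempty (Fin M) := β.index_nonempty
  exact ⟨((φ.trans E).trans μ).mapTwoSidedIdeal.isSimpleOrder⟩
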